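/- Let $N\ge 0$ be an integer, $c\in\mathbb C$, and let $T(u)=(T_{ij}(u))_{1\le i,j\le N}$ be a matrix of formal series in $u^{-1}$ with coefficients in an associative unital $\mathbb C$-algebra (for instance operators on a vector space), such that $T_{ij}(u)=\delta_{ij}\mathbf 1+\sum_{\ell\ge0}T_{ij}[\ell]u^{-\ell-1}$ and $$R(u,v)\,(T(u)\otimes\mathbf I)(\mathbf I\otimes T(v))=(\mathbf I\otimes T(v))(T(u)\otimes\mathbf I)\,R(u,v),\qquad R(u,v)=\mathbf I\otimes\mathbf I+\frac{c}{u-v}\sum_{i,j=1}^N\mathcal E_{ij}\otimes\mathcal E_{ji},$$ where $\mathcal E_{ij}$ are the matrix units. By the Gauss decomposition of a matrix $M(u)$ of such series we mean $$M(u)=\mathbf F(u)\,\mathrm{diag}(k_1(u),\dots,k_N(u))\,\mathbf E(u),\qquad \mathbf F(u)=\mathbf I+\sum_{i<j}\mathcal E_{ij}\,\mathrm F_{ji}(u),\quad \mathbf E(u)=\mathbf I+\sum_{i<j}\mathcal E_{ji}\,\mathrm E_{ij}(u),$$ that is, for $i<j$, $$M_{ij}=\mathrm F_{ji}k_j+\sum_{\ell>j}\mathrm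 F_{\ell i}k_\ell\mathrm E_{j\ell},\qquad M_{ii}=k_i+\sum_{\ell>i}\mathrm F_{\ell i}k_\ell\mathrm E_{i\ell},\qquad M_{ji}=k_j\mathrm E_{ij}+\sum_{\ell>j}\mathrm F_{\ell j}k_\ell\mathrm E_{i\ell}.$$ It is called normal ordered because the $\mathrm F$'s stand on the left and the $\mathrm E$'s on the right. Then $T(u)$ is invertible and has a unique Gauss decomposition, with coordinates $\mathrm F_{ji}(u)$, $k_j(u)$, $\mathrm E_{ij}(u)$; the matrices $\mathbf F(u)$, $\mathbf E(u)$ and the shifted series $k_i(u-a)$ ($a\in\mathbb C$, re-expanded in $u^{-1}$) are invertible, and the $k_i(u-a)$, $k_j(u-b)$ commute with each other for all $i,j$ and $a,b\in\mathbb C$. Define $\tilde{\mathrm F}_{ji}(u)$, $\tilde{\mathrm E}_{ij}(u)$ for $i<j$ by $$\mathbf F(u)^{-1}=\mathbf I+\sum_{i<j}\mathcal E_{ij}\,\tilde{\mathrm F}_{ji}(u),\qquad \mathbf E(u)^{-1}=\mathbf I+\sum_{i<j}\mathcal E_{ji}\,\tilde{\mathrm E}_{ij}(u),$$ and put $\widehat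 T_{ij}(u)=\tilde T_{N+1-j,\,N+1-i}(u)$ with $\tilde T(u)=T(u)^{-1}$. Then $\widehat T(u)$ also has a unique Gauss decomposition, and its coordinates $\hat{\mathrm F}_{ji}(u)$, $\hat k_j(u)$, $\hat{\mathrm E}_{ij}(u)$ are, for $i<j$ and for all $j$ respectively, $$\hat{\mathrm F}_{ji}(u)=\tilde{\mathrm F}_{N+1-i,\,N+1-j}\bigl(u-(N-j+1)c\bigr),\qquad \hat{\mathrm E}_{ij}(u)=\tilde{\mathrm E}_{N+1-j,\,N+1-i}\bigl(u-(N-j+1)c\bigr),$$ $$\hat k_j(u)=\frac{1}{k_{N+1-j}(u-(N-j)c)}\prod_{\ell=1}^{N-j}\frac{k_\ell(u-\ell c)}{k_\ell(u-(\ell-1)c)}.$$ -/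

import Mathlib

open scoped PowerSeries Kronecker

noncomputable section

namespace GaussRTT

/-!
Generating series in `u⁻¹`.  Throughout `A` is a (noncommutative) associative unital complex
algebra, in which the modes of the monodromy matrix live (operators on the space of states), and the
series `f(u) = ∑ₙ fₙ u⁻ⁿ` is the formal power series `f : A⟦X⟧` with `X = u⁻¹`.
-/

/-- The expansion `(u - a)⁻¹ = ∑ₖ aᵏ u⁻ᵏ⁻¹`, as a power series in `X = u⁻¹`. -/
def shiftedVar (a : ℂ) : ℂ⟦X⟧ :=
  PowerSeries.X * PowerSeries.mk fun k => a ^ k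

/-- `shift a f` is the series `f(u - a) = ∑ₘ fₘ (u - a)⁻ᵐ`, reexpanded in `u⁻¹`.
As `(u - a)⁻ᵐ` is `O(u⁻ᵐ)`, only the terms with `m ≤ n` contribute to the coefficient of `u⁻ⁿ`. -/
def shift {A : Type*} [Ring A] [Algebra ℂ A] (a : ℂ) (f : A⟦X⟧) : A⟦X⟧ :=
  PowerSeries.mk fun n =>
    ∑ m ∈ Finset.range (n + 1),
      PowerSeries.coeff n (shiftedVar a ^ m) • PowerSeries.coeff m f

/-!
Two spectral parameters: `A⟦X⟧⟦X⟧` is the ring of formal series in `u⁻¹` (outer variable) and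
`v⁻¹` (inner variable), which are central and commute with each other.
-/

section TwoParameters

variable (A : Type*) [Ring A] [Algebra ℂ A]

/-- `f ↦ f(u)`. -/
def atU : A⟦X⟧ →+* A⟦X⟧⟦X⟧ := PowerSeries.map PowerSeries.C

/-- `f ↦ f(v)`. -/
def atV : A⟦X⟧ →+* A⟦X⟧⟦X⟧ := PowerSeries.C

/-- `u⁻¹` as a series in two variables. -/
def uInv : A⟦X⟧⟦X⟧ := PowerSeries.X

/-- `v⁻¹` as a series in two variables. -/
def vInv : A⟦X⟧⟦X⟧ := PowerSeries.C PowerSeries.X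

/-- The permutation operator `P = ∑ᵢⱼ Eᵢⱼ ⊗ Eⱼᵢ`. -/
def permOp (N : ℕ) : Matrix (Fin N × Fin N) (Fin N × Fin N) A⟦X⟧⟦X⟧ :=
  ∑ i, ∑ j, Matrix.single i j 1 ⊗ₖ Matrix.single j i 1

/-- The R-matrix `R(u,v) = I ⊗ I + c / (u - v) P` with its denominator cleared, that is, multiplied
by the scalar `u⁻¹ v⁻¹ (u - v) = v⁻¹ - u⁻¹`, which is not a zero divisor. -/
def clearedR (N : ℕ) (c : ℂ) : Matrix (Fin N × Fin N) (Fin N × Fin N) A⟦X⟧⟦X⟧ :=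
  (vInv A - uInv A) • 1 + (c • (uInv A * vInv A)) • permOp A N

end TwoParameters

variable {A : Type*} [Ring A] [Algebra ℂ A] {N : ℕ}

/-- The RTT relation
`R(u,v) (T(u) ⊗ I) (I ⊗ T(v)) = (I ⊗ T(v)) (T(u) ⊗ I) R(u,v)`
for a matrix of generating series. -/
def RTT (c : ℂ) (T : Matrix (Fin N) (Fin N) A⟦X⟧) : Prop :=
  clearedR A N c * (T.map (atU A) ⊗ₖ 1) * (1 ⊗ₖ T.map (atV A)) =
    (1 ⊗ₖ T.map (atV A)) * (T.map (atU A) ⊗ₖ 1) * clearedR A N c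

/-- A monodromy matrix: it satisfies the RTT relation, and `Tᵢⱼ(u) = δᵢⱼ + O(u⁻¹)`. -/
structure IsMonodromy (c : ℂ) (T : Matrix (Fin N) (Fin N) A⟦X⟧) : Prop where
  rtt : RTT c T
  constantCoeff : T.map PowerSeries.constantCoeff = 1

/-- `T̂ᵢⱼ(u) = T̃_{N+1-j, N+1-i}(u)`, where `T̃(u)` is the inverse of the matrix `T(u)`.
With indices in `Fin N`, the reflection `i ↦ N + 1 - i` is `Fin.rev`. -/
def hatT (T : Matrix (Fin N) (Fin N) A⟦X⟧) : Matrix (Fin N) (Fin N) A⟦X⟧ :=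
  Matrix.of fun i j => Ring.inverse T j.rev i.rev

/-- A triple of candidates for the Gauss coordinates. For `i < j` the coordinate `F_{ji}(u)` is the
entry `F i j`, and the coordinate `E_{ij}(u)` is the entry `E j i`. -/
@[ext]
structure GaussData (A : Type*) [Ring A] (N : ℕ) where
  F : Matrix (Fin N) (Fin N) A⟦X⟧
  k : Fin N → A⟦X⟧
  E : Matrix (Fin N) (Fin N) A⟦X⟧

/-- The (normal ordered) Gauss decomposition `T(u) = F(u) D(u) E(u)`, with `F(u)` upper triangular
and `E(u)` lower triangular, both with units on the diagonal, and `D(u) = diag(k₁(u), …, k_N(u))`. -/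
structure IsGaussDecomposition (T : Matrix (Fin N) (Fin N) A⟦X⟧) (G : GaussData A N) : Prop where
  F_diag : ∀ i, G.F i i = 1
  F_upper : ∀ i j, j < i → G.F i j = 0
  E_diag : ∀ i, G.E i i = 1
  E_lower : ∀ i j, i < j → G.E i j = 0
  eq : T = G.F * Matrix.diagonal G.k * G.E

namespace GaussData

/-- The coordinate `F̃_{ba}(u)`, the entry of `F(u)⁻¹` in row `a` and column `b`. -/
def tildeF (G : GaussData A N) (b a : Fin N) : A⟦X⟧ := Ring.inverse G.F a b

/-- The coordinate `Ẽ_{ab}(u)`, the entry of `E(u)⁻¹` in row `b` and column `a`. -/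
def tildeE (G : GaussData A N) (a b : Fin N) : A⟦X⟧ := Ring.inverse G.E b a

/-- The hatted coordinates. If `j : Fin N` stands for the index `j + 1` of `1, …, N`, then
`j.rev` has the value `N - (j + 1)` and stands for the index `N + 1 - (j + 1)`. So in the usual
indices, for `i < j`,
`F̂_{ji}(u) = F̃_{N+1-i, N+1-j}(u - (N-j+1)c)`,
`Ê_{ij}(u) = Ẽ_{N+1-j, N+1-i}(u - (N-j+1)c)`,
`k̂_j(u) = k_{N+1-j}(u - (N-j)c)⁻¹ ∏_{ℓ=1}^{N-j} k_ℓ(u - ℓc) k_ℓ(u - (ℓ-1)c)⁻¹`. -/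
def hat (c : ℂ) (G : GaussData A N) : GaussData A N where
  F := Matrix.of fun i j =>
    if i = j then 1
    else if i < j then shift ((((j.rev : ℕ) : ℂ) + 1) * c) (G.tildeF i.rev j.rev)
    else 0
  k := fun j =>
    Ring.inverse (shift (((j.rev : ℕ) : ℂ) * c) (G.k j.rev)) *
      (((List.finRange N).filter fun l : Fin N => l < j.rev).map fun l : Fin N =>
        shift ((((l : ℕ) : ℂ) + 1) * c) (G.k l) *
          Ring.inverse (shift (((l : ℕ) : ℂ) * c) (G.k l))).prod
  E := Matrix.of fun j i =>
    if i = j then 1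
    else if i < j then shift ((((j.rev : ℕ) : ℂ) + 1) * c) (G.tildeE j.rev i.rev)
    else 0

end GaussData

end GaussRTT

end

/-!
Write `t(u) = T(u)⁻¹` and let all indices start at `1`. The Gauss decomposition is computed by
removing the *first* index: the trailing block of `T` (indices `≥ 2`) only involves the trailing
coordinates, and these determine the first row of `F`, the first column of `E` and `k₁`. This gives
existence and uniqueness (`exists_isGaussDecomposition`, `IsGaussDecomposition.unique`), and, as
`t = E⁻¹ D⁻¹ F⁻¹`,
`t₁₁ = k₁⁻¹`, `t₁ₐ = k₁⁻¹ Xₐ`, `t_{b1} = Y_b k₁⁻¹`, `t_{ba} = Y_b k₁⁻¹ Xₐ + τ_{ba}`,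
where `X` is the first row of `F⁻¹`, `Y` the first column of `E⁻¹`, and `τ` the inverse of the
trailing block.

What has to be shown about `T̂` is a formula for `t_{ba}` in which the entries of `F⁻¹` stand on the
left of those of `E⁻¹`. Two consequences of the RTT relation suffice.

* Multiplied by `T(v)⁻¹` from both sides, the relation says that `T_{ij}(u)` commutes with
  `t_{kl}(v)` if `i ≠ l` and `j ≠ k` (`IsMonodromy.commute_ringInverse`). So `k₁(u) = t₁₁(u)⁻¹`
  commutes with the trailing block of `T(v)`, and therefore with its Gauss coordinates, since
  conjugation by `k₁(u)` fixes the block and the decomposition is unique. In particular all `k`s commute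
  (`IsMonodromy.commute_k`).
* The relation for `t(u)` and `t(v)` degenerates at `u = v - c`, where the R-matrix is `I ⊗ I - P`
  if `c ≠ 0` (`IsMonodromy.fusion`). For three choices of the indices it reads
  `k₁(u)⁻¹ Xₐ(u) = Xₐ(u - c) k₁(u)⁻¹`, `Y_b(u) k₁(u)⁻¹ = k₁(u)⁻¹ Y_b(u - c)` and
  `t_{ba}(u) = Xₐ(u - c) k₁(u)⁻¹ Y_b(u - c) + τ_{ba}(u - c) k₁(u - c) k₁(u)⁻¹`.

The last identity is a recursion in `N`, because the trailing block satisfies the RTT relation too;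
its solution is `IsMonodromy.ringInverse_apply_eq_sum`, and reversing the order of the indices turns
it into the Gauss decomposition of `T̂` with the hatted coordinates. The specialization `u = v - c`
of a series in `u⁻¹` and `v⁻¹` is the ring homomorphism `evalU c`, which is also used to see that
`f(u) ↦ f(u - a)` is multiplicative.
-/

noncomputable section

namespace GaussRTT

open PowerSeries

/-! ### Specialization of the spectral parameter and the shift homomorphism -/

section Series

variable {A : Type*} [Ring A] [Algebra ℂ A]

/-- The expansion of `(u - a)⁻¹` as a series over `A`. -/
def shiftedVarIn (A : Type*) [Ring A] [Algebra ℂ A] (a : ℂ) : A⟦X⟧ :=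
  PowerSeries.map (algebraMap ℂ A) (shiftedVar a)

lemma commute_map_algebraMap (p : ℂ⟦X⟧) (f : A⟦X⟧) :
    Commute (PowerSeries.map (algebraMap ℂ A) p) f := by
  ext n
  rw [coeff_mul, coeff_mul, ← Finset.Nat.sum_antidiagonal_swap]
  refine Finset.sum_congr rfl fun x _ => ?_
  simp [Algebra.commutes]

lemma shiftedVarIn_commute (a : ℂ) (f : A⟦X⟧) : Commute (shiftedVarIn A a) f :=
  commute_map_algebraMap (shiftedVar a) f

lemma shiftedVarIn_pow_commute (a : ℂ) (m : ℕ) (f : A⟦X⟧) :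
    Commute (shiftedVarIn A a ^ m) f :=
  (shiftedVarIn_commute a f).pow_left m

lemma coeff_shiftedVarIn_pow_mul_of_lt (a : ℂ) {m n : ℕ} (h : n < m) (f : A⟦X⟧) :
    coeff n (shiftedVarIn A a ^ m * f) = 0 := by
  have : shiftedVarIn A a =
      X * PowerSeries.map (algebraMap ℂ A) (PowerSeries.mk fun k => a ^ k) := by
    simp [shiftedVarIn, shiftedVar]
  rw [this, (PowerSeries.commute_X _).symm.mul_pow, mul_assoc, coeff_X_pow_mul', if_neg (by omega)]

/-- The value of `f(u, v)` at `u = v - a`, as a function: `u⁻ᵐ` becomes `(v - a)⁻ᵐ`, which is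
`O(v⁻ᵐ)`, so that every coefficient is a finite sum. -/
def evalUFun (a : ℂ) (f : A⟦X⟧⟦X⟧) : A⟦X⟧ :=
  PowerSeries.mk fun n =>
    ∑ m ∈ Finset.range (n + 1), coeff n (shiftedVarIn A a ^ m * coeff m f)

lemma coeff_evalUFun (a : ℂ) (f : A⟦X⟧⟦X⟧) {n M : ℕ} (h : n < M) :
    coeff n (evalUFun a f) =
      coeff n (∑ m ∈ Finset.range M, shiftedVarIn A a ^ m * coeff m f) := by
  rw [evalUFun, coeff_mk, map_sum]
  refine Finset.sum_subset (Finset.range_mono h) fun m _ hm => ?_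
  exact coeff_shiftedVarIn_pow_mul_of_lt a (by simpa using hm) _

lemma evalUFun_mul (a : ℂ) (f g : A⟦X⟧⟦X⟧) :
    evalUFun a (f * g) = evalUFun a f * evalUFun a g := by
  ext n
  have h : coeff n (evalUFun a f * evalUFun a g) =
      coeff n ((∑ m ∈ Finset.range (n + 1), shiftedVarIn A a ^ m * coeff m f) *
        ∑ m ∈ Finset.range (n + 1), shiftedVarIn A a ^ m * coeff m g) := by
    rw [coeff_mul, coeff_mul]
    refine Finset.sum_congr rfl fun x hx => ?_
    have := Finset.HasAntidiagonal.mem_antidiagonal.1 hx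
    rw [coeff_evalUFun a f (M := n + 1) (by omega), coeff_evalUFun a g (M := n + 1) (by omega)]
  rw [h, coeff_evalUFun a _ (Nat.lt_succ_self n), Finset.sum_mul_sum, map_sum]
  have h1 : ∀ k, coeff n (shiftedVarIn A a ^ k * coeff k (f * g)) =
      ∑ i ∈ Finset.range (k + 1),
        coeff n (shiftedVarIn A a ^ (i + (k - i)) * (coeff i f * coeff (k - i) g)) := by
    intro k
    rw [coeff_mul k f g, Finset.Nat.sum_antidiagonal_eq_sum_range_succ
      (fun i j => coeff i f * coeff j g), Finset.mul_sum, map_sum]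
    refine Finset.sum_congr rfl fun i hi => ?_
    rw [Nat.add_sub_cancel' (by simpa [Nat.lt_succ_iff] using hi)]
  simp_rw [h1]
  rw [Finset.sum_range_diag_flip (n + 1)
    (fun i j => coeff n (shiftedVarIn A a ^ (i + j) * (coeff i f * coeff j g))), map_sum]
  refine Finset.sum_congr rfl fun i _ => ?_
  rw [map_sum]
  refine (Finset.sum_subset (Finset.range_mono (Nat.sub_le _ _)) fun j _ hj => ?_).trans ?_
  · exact coeff_shiftedVarIn_pow_mul_of_lt a (by simp at hj; omega) _
  · refine Finset.sum_congr rfl fun j _ => ?_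
    rw [pow_add, mul_assoc, ← mul_assoc (_ ^ j), (shiftedVarIn_pow_commute a j _).eq]
    simp only [mul_assoc]

/-- Specialization at `u = v - a` as a ring homomorphism from series in `u⁻¹`, `v⁻¹` to series
in `v⁻¹`. -/
def evalU (a : ℂ) : A⟦X⟧⟦X⟧ →+* A⟦X⟧ where
  toFun := evalUFun a
  map_one' := by
    ext n
    rw [coeff_evalUFun a _ (Nat.lt_succ_self n), Finset.sum_eq_single 0]
    · simp
    · intro m _ hm
      simp [coeff_one, hm]
    · simp
  map_mul' := evalUFun_mul a
  map_zero' := by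
    ext n
    simp [evalUFun]
  map_add' f g := by
    ext n
    simp [evalUFun, mul_add, Finset.sum_add_distrib]

lemma evalU_atV (a : ℂ) (f : A⟦X⟧) : evalU a (atV A f) = f := by
  ext n
  change coeff n (evalUFun a _) = _
  rw [coeff_evalUFun a _ (Nat.lt_succ_self n), Finset.sum_eq_single 0]
  · simp [atV]
  · intro m _ hm
    simp [atV, coeff_C, hm]
  · simp

lemma evalU_atU (a : ℂ) (f : A⟦X⟧) : evalU a (atU A f) = shift a f := by
  ext n
  change coeff n (evalUFun a _) = _
  rw [coeff_evalUFun a _ (Nat.lt_succ_self n), shift, coeff_mk, map_sum]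
  refine Finset.sum_congr rfl fun m _ => ?_
  simp [atU, shiftedVarIn, ← map_pow, coeff_mul_C, Algebra.smul_def]

lemma evalU_uInv (a : ℂ) : evalU a (uInv A) = shiftedVarIn A a := by
  ext n
  change coeff n (evalUFun a _) = _
  rw [coeff_evalUFun a _ (by omega : n < n + 2), Finset.sum_eq_single 1]
  · simp [uInv]
  · intro m _ hm
    simp [uInv, coeff_X, hm]
  · simp

/-- `f(u) ↦ f(u - a)` as a ring homomorphism. -/
def shiftHom (a : ℂ) : A⟦X⟧ →+* A⟦X⟧ := (evalU a).comp (atU A)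

lemma shiftHom_apply (a : ℂ) (f : A⟦X⟧) : shiftHom a f = shift a f := evalU_atU a f

lemma shift_one (a : ℂ) : shift a (1 : A⟦X⟧) = 1 := by
  rw [← shiftHom_apply, map_one]

lemma shift_zero_series (a : ℂ) : shift a (0 : A⟦X⟧) = 0 := by
  rw [← shiftHom_apply, map_zero]

lemma shift_mul (a : ℂ) (f g : A⟦X⟧) : shift a (f * g) = shift a f * shift a g := by
  simp only [← shiftHom_apply, map_mul]

lemma shift_add (a : ℂ) (f g : A⟦X⟧) : shift a (f + g) = shift a f + shift a g := by
  simp only [← shiftHom_apply, map_add]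

lemma shift_sum {ι : Type*} (s : Finset ι) (a : ℂ) (f : ι → A⟦X⟧) :
    shift a (∑ i ∈ s, f i) = ∑ i ∈ s, shift a (f i) := by
  simp only [← shiftHom_apply, map_sum]

lemma shift_ringInverse (a : ℂ) {f : A⟦X⟧} (hf : IsUnit f) :
    shift a (Ring.inverse f) = Ring.inverse (shift a f) := by
  obtain ⟨x, rfl⟩ := hf
  rw [Ring.inverse_unit, ← shiftHom_apply, ← shiftHom_apply]
  exact (Ring.inverse_unit (Units.map (shiftHom a : A⟦X⟧ →+* A⟦X⟧).toMonoidHom x)).symm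

lemma isUnit_shift (a : ℂ) {f : A⟦X⟧} (hf : IsUnit f) : IsUnit (shift a f) := by
  rw [← shiftHom_apply]
  exact hf.map _

lemma shiftedVar_mul_one_sub (a : ℂ) : shiftedVar a * (1 - C a * X) = X := by
  have : (PowerSeries.mk fun k => a ^ k) * (1 - C a * X) = 1 := by
    ext n
    rw [mul_sub, mul_one, ← mul_assoc, mul_comm _ (C a), mul_assoc, map_sub, coeff_C_mul]
    cases n with
    | zero => simp
    | succ n => simp [coeff_succ_mul_X, coeff_one, pow_succ']
  rw [shiftedVar, mul_assoc, this, mul_one]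

lemma shift_X (a : ℂ) : shift a (X : A⟦X⟧) = shiftedVarIn A a := by
  rw [← evalU_uInv, ← evalU_atU]
  simp [atU, uInv]

lemma shift_C (a : ℂ) (x : A) : shift a (C x) = C x := by
  have : atU A (C x) = atV A (C x) := by simp [atU, atV]
  rw [← evalU_atU, this, evalU_atV]

lemma shift_shiftedVar (a b : ℂ) : shift a (shiftedVar b) = shiftedVar (a + b) := by
  have key : ∀ (d : ℂ) (y : ℂ⟦X⟧), y * (1 - C d * X) = X → y = shiftedVar d := by
    intro d y hy
    have hne : (1 - C d * X : ℂ⟦X⟧) ≠ 0 := fun h => by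
      simpa using congrArg constantCoeff h
    exact mul_right_cancel₀ hne (hy.trans (shiftedVar_mul_one_sub d).symm)
  have hX : shift a (X : ℂ⟦X⟧) = shiftedVar a := by
    rw [shift_X, shiftedVarIn, Algebra.algebraMap_self, PowerSeries.map_id, id_eq]
  have h1 := congrArg (shiftHom a) (shiftedVar_mul_one_sub b)
  simp only [map_mul, map_sub, map_one, shiftHom_apply, shift_C, hX] at h1
  refine key _ _ ?_
  rw [map_add]
  linear_combination (1 - C a * X) * h1 +
    (1 + shift a (shiftedVar b) * C b) * shiftedVar_mul_one_sub a

lemma shift_shift (a b : ℂ) (f : A⟦X⟧) : shift a (shift b f) = shift (a + b) f := by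
  have hs : ∀ l : ℕ, shift a (shiftedVar b ^ l) = shiftedVar (a + b) ^ l := by
    intro l
    rw [← shiftHom_apply, map_pow, shiftHom_apply, shift_shiftedVar]
  have hv : ∀ {m l : ℕ}, m < l → coeff m (shiftedVar b ^ l) = 0 := by
    intro m l h
    rw [shiftedVar, mul_pow, coeff_X_pow_mul', if_neg (by omega)]
  ext n
  simp only [shift, coeff_mk]
  have h1 : ∀ m ∈ Finset.range (n + 1),
      coeff n (shiftedVar a ^ m) • ∑ l ∈ Finset.range (m + 1),
        coeff m (shiftedVar b ^ l) • coeff l f =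
      ∑ l ∈ Finset.range (n + 1),
        (coeff n (shiftedVar a ^ m) * coeff m (shiftedVar b ^ l)) • coeff l f := by
    intro m hm
    rw [Finset.smul_sum]
    refine (Finset.sum_subset (Finset.range_mono (Finset.mem_range.1 hm)) fun l _ hl => ?_).trans
      (Finset.sum_congr rfl fun l _ => smul_smul _ _ _)
    rw [hv (by simpa using hl), zero_smul, smul_zero]
  rw [Finset.sum_congr rfl h1, Finset.sum_comm]
  refine Finset.sum_congr rfl fun l _ => ?_
  rw [← Finset.sum_smul, ← hs l, shift, coeff_mk]
  simp [smul_eq_mul]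

lemma shift_zero (f : A⟦X⟧) : shift 0 f = f := by
  have : shiftedVar 0 = X := by simpa using shiftedVar_mul_one_sub 0
  ext n
  simp [shift, this, coeff_X_pow, ite_smul]

end Series

/-! ### Series with commuting coefficients, and cancellation in two spectral parameters -/

section TwoParameters

variable {A : Type*} [Ring A]

lemma commute_atU_atV_iff {f g : A⟦X⟧} :
    Commute (atU A f) (atV A g) ↔ ∀ m n, Commute (coeff m f) (coeff n g) := by
  constructor
  · intro h m n
    have := congrArg (fun p => coeff n (coeff m p)) h.eq
    simp only [atU, atV, coeff_mul_C, coeff_C_mul, coeff_map] at this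
    exact this
  · intro h
    refine PowerSeries.ext fun m => PowerSeries.ext fun n => ?_
    simpa [atU, atV, coeff_mul_C, coeff_C_mul] using (h m n).eq

lemma commute_atU_atV_symm {f g : A⟦X⟧} (h : Commute (atU A f) (atV A g)) :
    Commute (atU A g) (atV A f) :=
  commute_atU_atV_iff.2 fun m n => (commute_atU_atV_iff.1 h n m).symm

lemma commute_shift_shift [Algebra ℂ A] {f g : A⟦X⟧} (h : Commute (atU A f) (atV A g)) (a b : ℂ) :
    Commute (shift a f) (shift b g) := by
  rw [commute_atU_atV_iff] at h
  have hfg : ∀ m n, Commute (coeff m (shift a f)) (coeff n (shift b g)) := by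
    intro m n
    simp only [shift, coeff_mk]
    exact Commute.sum_left _ _ _ fun i _ => Commute.sum_right _ _ _ fun j _ =>
      ((h i j).smul_left _).smul_right _
  have := (commute_atU_atV_iff.2 hfg).map (evalU (0 : ℂ))
  rwa [evalU_atU, evalU_atV, shift_zero] at this

/-- A series `v⁻¹ + u⁻¹ q` is not a left zero divisor, whatever `q` is. -/
lemma eq_zero_of_vInv_add_mul (q f : A⟦X⟧⟦X⟧) (h : (vInv A + uInv A * q) * f = 0) : f = 0 := by
  have key : ∀ n, coeff n f = 0 := by
    intro n
    induction n using Nat.strong_induction_on with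
    | _ n ih =>
      have h1 := congrArg (coeff n) h
      rw [add_mul, map_add, vInv, coeff_C_mul, map_zero, uInv, mul_assoc] at h1
      have h2 : coeff n (X * (q * f)) = 0 := by
        cases n with
        | zero => simp
        | succ n =>
          rw [coeff_succ_X_mul, coeff_mul]
          refine Finset.sum_eq_zero fun x hx => ?_
          have := Finset.HasAntidiagonal.mem_antidiagonal.1 hx
          rw [ih x.2 (by omega), mul_zero]
      rw [h2, add_zero] at h1
      exact PowerSeries.X_mul_injective (by simpa using h1)
  ext n : 1
  simp [key n]

end TwoParameters

/-! ### Triangular matrices over a noncommutative ring -/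

section Triangular

variable {B : Type*} [Ring B] {N : ℕ}

/-- A matrix whose entries vanish unless the weight strictly increases from row to column is
nilpotent. -/
lemma isNilpotent_of_weight (w : Fin N → ℕ) (S : Matrix (Fin N) (Fin N) B)
    (h : ∀ i j, ¬ w i < w j → S i j = 0) : IsNilpotent S := by
  have hp : ∀ (k : ℕ) (i j : Fin N), w j < w i + k → (S ^ k) i j = 0 := by
    intro k
    induction k with
    | zero =>
      intro i j hij
      rw [pow_zero, Matrix.one_apply_ne]
      rintro rfl
      omega
    | succ k ih =>
      intro i j hij
      rw [pow_succ, Matrix.mul_apply]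
      refine Finset.sum_eq_zero fun l _ => ?_
      by_cases hl : w l < w i + k
      · rw [ih i l hl, zero_mul]
      · rw [h l j (by omega), mul_zero]
  refine ⟨(∑ i, w i) + 1, ?_⟩
  ext i j
  refine hp _ i j ?_
  have := Finset.single_le_sum (f := w) (fun _ _ => Nat.zero_le _) (Finset.mem_univ j)
  omega

lemma isUnit_of_weight (w : Fin N → ℕ) (M : Matrix (Fin N) (Fin N) B) (hd : ∀ i, M i i = 1)
    (h : ∀ i j, i ≠ j → ¬ w i < w j → M i j = 0) : IsUnit M := by
  have : IsNilpotent (M - 1) := isNilpotent_of_weight w _ fun i j hij => by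
    by_cases e : i = j
    · subst e
      simp [hd]
    · simp [Matrix.one_apply_ne e, h i j e hij]
  simpa using this.isUnit_one_add

lemma isUnit_of_upper {M : Matrix (Fin N) (Fin N) B} (hd : ∀ i, M i i = 1)
    (h : ∀ i j, j < i → M i j = 0) : IsUnit M :=
  isUnit_of_weight (fun i => i) M hd fun i j e hij =>
    h i j (lt_of_le_of_ne (not_lt.1 hij) (Ne.symm e))

lemma isUnit_of_lower {M : Matrix (Fin N) (Fin N) B} (hd : ∀ i, M i i = 1)
    (h : ∀ i j, i < j → M i j = 0) : IsUnit M :=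
  isUnit_of_weight (fun i => i.rev) M hd fun i j e hij =>
    h i j (lt_of_le_of_ne (Fin.rev_le_rev.1 (not_lt.1 hij)) e)

lemma ringInverse_eq_of_mul_eq_one {R : Type*} [Ring R] {x y : R} (hx : IsUnit x) (h : x * y = 1) :
    Ring.inverse x = y := by
  obtain ⟨x, rfl⟩ := hx
  rw [Ring.inverse_unit, ← mul_one (↑x⁻¹ : R), ← h, Units.inv_mul_cancel_left]

lemma isUnit_diagonal {k : Fin N → B} (hk : ∀ i, IsUnit (k i)) : IsUnit (Matrix.diagonal k) :=
  (Pi.isUnit_iff.2 hk).map (Matrix.diagonalRingHom (Fin N) B)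

lemma ringInverse_diagonal {k : Fin N → B} (hk : ∀ i, IsUnit (k i)) :
    Ring.inverse (Matrix.diagonal k) = Matrix.diagonal fun i => Ring.inverse (k i) := by
  refine ringInverse_eq_of_mul_eq_one (isUnit_diagonal hk) ?_
  rw [Matrix.diagonal_mul_diagonal, ← Matrix.diagonal_one]
  congr 1
  ext1 i
  exact Ring.mul_inverse_cancel _ (hk i)

end Triangular

/-! ### Existence and uniqueness of the Gauss decomposition -/

section Gauss

variable {A : Type*} [Ring A] {N : ℕ}

/-- The coordinates with the first index removed. -/
def GaussData.tail (G : GaussData A (N + 1)) : GaussData A N where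
  F := G.F.submatrix Fin.succ Fin.succ
  k := G.k ∘ Fin.succ
  E := G.E.submatrix Fin.succ Fin.succ

namespace IsGaussDecomposition

lemma isUnit_F {T : Matrix (Fin N) (Fin N) A⟦X⟧} {G : GaussData A N}
    (h : IsGaussDecomposition T G) : IsUnit G.F := isUnit_of_upper h.F_diag h.F_upper

lemma isUnit_E {T : Matrix (Fin N) (Fin N) A⟦X⟧} {G : GaussData A N}
    (h : IsGaussDecomposition T G) : IsUnit G.E := isUnit_of_lower h.E_diag h.E_lower

lemma apply {T : Matrix (Fin N) (Fin N) A⟦X⟧} {G : GaussData A N}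
    (h : IsGaussDecomposition T G) (i j : Fin N) : T i j = ∑ l, G.F i l * G.k l * G.E l j := by
  rw [h.eq, Matrix.mul_apply]
  simp only [Matrix.mul_diagonal]

variable {T : Matrix (Fin (N + 1)) (Fin (N + 1)) A⟦X⟧} {G : GaussData A (N + 1)}

/-- Since the factor `F` is upper and `E` is lower triangular, the trailing block of `T` only
involves the trailing coordinates. -/
lemma tail (h : IsGaussDecomposition T G) :
    IsGaussDecomposition (T.submatrix Fin.succ Fin.succ) G.tail where
  F_diag i := h.F_diag _
  F_upper i j hij := h.F_upper _ _ (Fin.succ_lt_succ_iff.2 hij)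
  E_diag i := h.E_diag _
  E_lower i j hij := h.E_lower _ _ (Fin.succ_lt_succ_iff.2 hij)
  eq := by
    ext1 i j
    rw [Matrix.submatrix_apply, h.apply, Fin.sum_univ_succ, h.F_upper _ _ (Fin.succ_pos i),
      zero_mul, zero_mul, zero_add, Matrix.mul_apply]
    simp [GaussData.tail, Matrix.mul_diagonal]

lemma apply_zero_succ (h : IsGaussDecomposition T G) :
    (fun j : Fin N => T 0 j.succ) =
      Matrix.vecMul (fun l : Fin N => G.F 0 l.succ) (Matrix.diagonal G.tail.k * G.tail.E) := by
  ext1 j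
  rw [h.apply, Fin.sum_univ_succ, h.E_lower _ _ (Fin.succ_pos j), mul_zero, zero_add]
  simp [GaussData.tail, Matrix.vecMul, dotProduct, Matrix.diagonal_mul, mul_assoc]

lemma apply_succ_zero (h : IsGaussDecomposition T G) :
    (fun i : Fin N => T i.succ 0) =
      Matrix.mulVec (G.tail.F * Matrix.diagonal G.tail.k) (fun l : Fin N => G.E l.succ 0) := by
  ext1 i
  rw [h.apply, Fin.sum_univ_succ, h.F_upper _ _ (Fin.succ_pos i), zero_mul, zero_mul, zero_add]
  simp [GaussData.tail, Matrix.mulVec, dotProduct, Matrix.mul_diagonal]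

lemma apply_zero_zero (h : IsGaussDecomposition T G) :
    T 0 0 = G.k 0 + ∑ l : Fin N, G.F 0 l.succ * G.k l.succ * G.E l.succ 0 := by
  rw [h.apply, Fin.sum_univ_succ, h.F_diag, h.E_diag, one_mul, mul_one]

end IsGaussDecomposition

lemma vecMul_injective {B : Type*} [Ring B] {M : Matrix (Fin N) (Fin N) B} (hM : IsUnit M)
    {x y : Fin N → B}
    (h : Matrix.vecMul x M = Matrix.vecMul y M) : x = y := by
  have := congrArg (fun z => Matrix.vecMul z (Ring.inverse M)) h
  simpa [Matrix.vecMul_vecMul, Ring.mul_inverse_cancel _ hM] using this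

lemma mulVec_injective {B : Type*} [Ring B] {M : Matrix (Fin N) (Fin N) B} (hM : IsUnit M)
    {x y : Fin N → B}
    (h : Matrix.mulVec M x = Matrix.mulVec M y) : x = y := by
  have := congrArg (fun z => Matrix.mulVec (Ring.inverse M) z) h
  simpa [Matrix.mulVec_mulVec, Ring.inverse_mul_cancel _ hM] using this

/-- A Gauss decomposition with invertible `k`s is unique: the trailing block determines the trailing
coordinates, the first row and the first column of `T` then determine those of `F` and `E`, and the
corner entry determines the first `k`. -/
theorem IsGaussDecomposition.unique {N : ℕ} {T : Matrix (Fin N) (Fin N) A⟦X⟧} {G G' : GaussData A N}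
    (h : IsGaussDecomposition T G) (hk : ∀ i, IsUnit (G.k i)) (h' : IsGaussDecomposition T G') :
    G' = G := by
  induction N with
  | zero => ext i <;> exact i.elim0
  | succ N ih =>
    have ht : G'.tail = G.tail := ih h.tail (fun i => hk _) h'.tail
    have hD : IsUnit (Matrix.diagonal G.tail.k) := isUnit_diagonal fun i => hk _
    have hF0 : (fun l : Fin N => G'.F 0 l.succ) = fun l : Fin N => G.F 0 l.succ := by
      refine vecMul_injective (hD.mul h.tail.isUnit_E) ?_
      rw [← h.apply_zero_succ, h'.apply_zero_succ, ht]
    have hE0 : (fun l : Fin N => G'.E l.succ 0) = fun l : Fin N => G.E l.succ 0 := by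
      refine mulVec_injective (h.tail.isUnit_F.mul hD) ?_
      rw [← h.apply_succ_zero, h'.apply_succ_zero, ht]
    have hks : ∀ l : Fin N, G'.k l.succ = G.k l.succ := fun l =>
      congrFun (congrArg GaussData.k ht) l
    have hk0 : G'.k 0 = G.k 0 := by
      have h0 := h'.apply_zero_zero
      rw [h.apply_zero_zero] at h0
      simp only [hks, fun l => congrFun hF0 l, fun l => congrFun hE0 l] at h0
      exact (add_right_cancel h0).symm
    have hF : G'.F = G.F := by
      ext1 i j
      induction i using Fin.cases with
      | zero =>
        induction j using Fin.cases with
        | zero => rw [h.F_diag, h'.F_diag]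
        | succ j => exact congrFun hF0 j
      | succ i =>
        induction j using Fin.cases with
        | zero => rw [h.F_upper _ _ (Fin.succ_pos i), h'.F_upper _ _ (Fin.succ_pos i)]
        | succ j => exact congrFun (congrFun (congrArg GaussData.F ht) i) j
    have hE : G'.E = G.E := by
      ext1 i j
      induction j using Fin.cases with
      | zero =>
        induction i using Fin.cases with
        | zero => rw [h.E_diag, h'.E_diag]
        | succ i => exact congrFun hE0 i
      | succ j =>
        induction i using Fin.cases with
        | zero => rw [h.E_lower _ _ (Fin.succ_pos j), h'.E_lower _ _ (Fin.succ_pos j)]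
        | succ i => exact congrFun (congrFun (congrArg GaussData.E ht) i) j
    refine GaussData.ext hF ?_ hE
    ext1 i
    induction i using Fin.cases with
    | zero => exact hk0
    | succ i => exact hks i

/-- Existence of the Gauss decomposition for a matrix of series with constant term `1`, by the
recursion that the uniqueness proof describes. -/
theorem exists_isGaussDecomposition {N : ℕ} (T : Matrix (Fin N) (Fin N) A⟦X⟧)
    (hT : T.map PowerSeries.constantCoeff = 1) :
    ∃ G : GaussData A N, IsGaussDecomposition T G ∧ ∀ i, IsUnit (G.k i) := by
  induction N with
  | zero =>
    refine ⟨⟨1, 1, 1⟩, ⟨fun i => i.elim0, fun i => i.elim0, fun i => i.elim0, fun i => i.elim0, ?_⟩,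
      fun i => i.elim0⟩
    ext i
    exact i.elim0
  | succ N ih =>
    have hc : ∀ i j, constantCoeff (T i j) = (1 : Matrix (Fin (N + 1)) (Fin (N + 1)) A) i j :=
      fun i j => by rw [← hT]; rfl
    obtain ⟨G, hG, hk⟩ := ih (T.submatrix Fin.succ Fin.succ) (by
      ext i j
      simp [hc, Matrix.one_apply])
    have hD : IsUnit (Matrix.diagonal G.k) := isUnit_diagonal hk
    have hDE := hD.mul hG.isUnit_E
    have hFD := hG.isUnit_F.mul hD
    let f : Fin N → A⟦X⟧ :=
      Matrix.vecMul (fun j => T 0 j.succ) (Ring.inverse (Matrix.diagonal G.k * G.E))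
    let e : Fin N → A⟦X⟧ :=
      Matrix.mulVec (Ring.inverse (G.F * Matrix.diagonal G.k)) (fun i => T i.succ 0)
    have hf : Matrix.vecMul f (Matrix.diagonal G.k * G.E) = fun j => T 0 j.succ := by
      simp [f, Matrix.vecMul_vecMul, Ring.inverse_mul_cancel _ hDE]
    have he : Matrix.mulVec (G.F * Matrix.diagonal G.k) e = fun i => T i.succ 0 := by
      simp [e, Matrix.mulVec_mulVec, Ring.mul_inverse_cancel _ hFD]
    have hf0 : ∀ l, constantCoeff (f l) = 0 := fun l => by
      simp [f, Matrix.vecMul, dotProduct, hc, (Fin.succ_ne_zero _).symm]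
    let k0 : A⟦X⟧ := T 0 0 - ∑ l, f l * G.k l * e l
    have hk0 : IsUnit k0 := by
      rw [PowerSeries.isUnit_iff_constantCoeff]
      simp [k0, hc, hf0]
    refine ⟨⟨Matrix.of (Fin.cons (Fin.cons 1 f) fun i => Fin.cons 0 (G.F i)), Fin.cons k0 G.k,
      Matrix.of (Fin.cons (Fin.cons 1 0) fun i => Fin.cons (e i) (G.E i))⟩,
      ⟨?_, ?_, ?_, ?_, ?_⟩, ?_⟩
    · intro i
      induction i using Fin.cases with
      | zero => simp
      | succ i => simp [hG.F_diag]
    · intro i j hij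
      induction i using Fin.cases with
      | zero => exact absurd hij (Fin.not_lt_zero j)
      | succ i =>
        induction j using Fin.cases with
        | zero => simp
        | succ j => simpa using hG.F_upper i j (Fin.succ_lt_succ_iff.1 hij)
    · intro i
      induction i using Fin.cases with
      | zero => simp
      | succ i => simp [hG.E_diag]
    · intro i j hij
      induction j using Fin.cases with
      | zero => exact absurd hij (Fin.not_lt_zero i)
      | succ j =>
        induction i using Fin.cases with
        | zero => simp
        | succ i => simpa using hG.E_lower i j (Fin.succ_lt_succ_iff.1 hij)
    · ext1 i j
      rw [Matrix.mul_apply, Fin.sum_univ_succ]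
      induction i using Fin.cases with
      | zero =>
        induction j using Fin.cases with
        | zero => simp [Matrix.mul_diagonal, k0]
        | succ j =>
          simpa [Matrix.mul_diagonal, Matrix.vecMul, dotProduct, Matrix.diagonal_mul, mul_assoc]
            using (congrFun hf j).symm
      | succ i =>
        induction j using Fin.cases with
        | zero =>
          simpa [Matrix.mul_diagonal, Matrix.mulVec, dotProduct] using (congrFun he i).symm
        | succ j => simpa [Matrix.mul_diagonal] using hG.apply i j
    · intro i
      induction i using Fin.cases with
      | zero => exact hk0
      | succ i => exact hk i

namespace IsGaussDecomposition

lemma isUnit {T : Matrix (Fin N) (Fin N) A⟦X⟧} {G : GaussData A N}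
    (h : IsGaussDecomposition T G) (hk : ∀ i, IsUnit (G.k i)) : IsUnit T := by
  rw [h.eq]
  exact (h.isUnit_F.mul (isUnit_diagonal hk)).mul h.isUnit_E

lemma ringInverse_apply {T : Matrix (Fin N) (Fin N) A⟦X⟧} {G : GaussData A N}
    (h : IsGaussDecomposition T G) (hk : ∀ i, IsUnit (G.k i)) (i j : Fin N) :
    Ring.inverse T i j =
      ∑ l, Ring.inverse G.E i l * Ring.inverse (G.k l) * Ring.inverse G.F l j := by
  have hD := isUnit_diagonal hk
  rw [h.eq, Ring.inverse_mul (.inr h.isUnit_E), Ring.inverse_mul (.inr hD), ringInverse_diagonal hk,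
    ← mul_assoc, Matrix.mul_apply]
  simp only [Matrix.mul_diagonal]

variable {T : Matrix (Fin (N + 1)) (Fin (N + 1)) A⟦X⟧} {G : GaussData A (N + 1)}

lemma ringInverse_F_zero_zero (h : IsGaussDecomposition T G) : Ring.inverse G.F 0 0 = 1 := by
  have := Matrix.ext_iff.2 (Ring.inverse_mul_cancel _ h.isUnit_F) 0 0
  rw [Matrix.mul_apply, Fin.sum_univ_succ] at this
  simpa [h.F_diag, h.F_upper _ _ (Fin.succ_pos _)] using this

lemma ringInverse_F_succ_zero (h : IsGaussDecomposition T G) (i : Fin N) :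
    Ring.inverse G.F i.succ 0 = 0 := by
  have := Matrix.ext_iff.2 (Ring.inverse_mul_cancel _ h.isUnit_F) i.succ 0
  rw [Matrix.mul_apply, Fin.sum_univ_succ] at this
  simpa [h.F_diag, h.F_upper _ _ (Fin.succ_pos _)] using this

lemma ringInverse_E_zero_zero (h : IsGaussDecomposition T G) : Ring.inverse G.E 0 0 = 1 := by
  have := Matrix.ext_iff.2 (Ring.mul_inverse_cancel _ h.isUnit_E) 0 0
  rw [Matrix.mul_apply, Fin.sum_univ_succ] at this
  simpa [h.E_diag, h.E_lower _ _ (Fin.succ_pos _)] using this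

lemma ringInverse_E_zero_succ (h : IsGaussDecomposition T G) (i : Fin N) :
    Ring.inverse G.E 0 i.succ = 0 := by
  have := Matrix.ext_iff.2 (Ring.mul_inverse_cancel _ h.isUnit_E) 0 i.succ
  rw [Matrix.mul_apply, Fin.sum_univ_succ] at this
  simpa [h.E_diag, h.E_lower _ _ (Fin.succ_pos _), Matrix.one_apply, Fin.ext_iff] using this

lemma ringInverse_tail_F (h : IsGaussDecomposition T G) (i j : Fin N) :
    Ring.inverse G.tail.F i j = Ring.inverse G.F i.succ j.succ := by
  have : Ring.inverse G.tail.F = (Ring.inverse G.F).submatrix Fin.succ Fin.succ := by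
    refine ringInverse_eq_of_mul_eq_one h.tail.isUnit_F ?_
    ext1 i j
    have := Matrix.ext_iff.2 (Ring.mul_inverse_cancel _ h.isUnit_F) i.succ j.succ
    rw [Matrix.mul_apply, Fin.sum_univ_succ, h.F_upper _ _ (Fin.succ_pos _), zero_mul,
      zero_add] at this
    rw [Matrix.mul_apply]
    simpa [GaussData.tail, Matrix.one_apply] using this
  rw [this, Matrix.submatrix_apply]

lemma ringInverse_tail_E (h : IsGaussDecomposition T G) (i j : Fin N) :
    Ring.inverse G.tail.E i j = Ring.inverse G.E i.succ j.succ := by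
  have : Ring.inverse G.tail.E = (Ring.inverse G.E).submatrix Fin.succ Fin.succ := by
    refine ringInverse_eq_of_mul_eq_one h.tail.isUnit_E ?_
    ext1 i j
    have := Matrix.ext_iff.2 (Ring.mul_inverse_cancel _ h.isUnit_E) i.succ j.succ
    rw [Matrix.mul_apply, Fin.sum_univ_succ, h.ringInverse_E_zero_succ, mul_zero,
      zero_add] at this
    rw [Matrix.mul_apply]
    simpa [GaussData.tail, Matrix.one_apply] using this
  rw [this, Matrix.submatrix_apply]

lemma ringInverse_zero_left (h : IsGaussDecomposition T G) (hk : ∀ i, IsUnit (G.k i))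
    (j : Fin (N + 1)) : Ring.inverse T 0 j = Ring.inverse (G.k 0) * Ring.inverse G.F 0 j := by
  rw [h.ringInverse_apply hk, Fin.sum_univ_succ, h.ringInverse_E_zero_zero, one_mul]
  simp [h.ringInverse_E_zero_succ]

lemma ringInverse_zero_right (h : IsGaussDecomposition T G) (hk : ∀ i, IsUnit (G.k i))
    (i : Fin (N + 1)) : Ring.inverse T i 0 = Ring.inverse G.E i 0 * Ring.inverse (G.k 0) := by
  rw [h.ringInverse_apply hk, Fin.sum_univ_succ, h.ringInverse_F_zero_zero, mul_one]
  simp [h.ringInverse_F_succ_zero]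

lemma ringInverse_zero_zero (h : IsGaussDecomposition T G) (hk : ∀ i, IsUnit (G.k i)) :
    Ring.inverse T 0 0 = Ring.inverse (G.k 0) := by
  rw [h.ringInverse_zero_left hk, h.ringInverse_F_zero_zero, mul_one]

lemma ringInverse_succ_succ (h : IsGaussDecomposition T G) (hk : ∀ i, IsUnit (G.k i))
    (i j : Fin N) : Ring.inverse T i.succ j.succ =
      Ring.inverse G.E i.succ 0 * Ring.inverse (G.k 0) * Ring.inverse G.F 0 j.succ +
        Ring.inverse (T.submatrix Fin.succ Fin.succ) i j := by
  rw [h.ringInverse_apply hk, Fin.sum_univ_succ, h.tail.ringInverse_apply fun i => hk _]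
  simp only [h.ringInverse_tail_E, h.ringInverse_tail_F]
  rfl

lemma ringInverse_F_diag {N : ℕ} {T : Matrix (Fin N) (Fin N) A⟦X⟧} {G : GaussData A N}
    (h : IsGaussDecomposition T G) (i : Fin N) : Ring.inverse G.F i i = 1 := by
  induction N with
  | zero => exact i.elim0
  | succ N ih =>
    induction i using Fin.cases with
    | zero => exact h.ringInverse_F_zero_zero
    | succ i => rw [← h.ringInverse_tail_F, ih h.tail]

lemma ringInverse_F_upper {N : ℕ} {T : Matrix (Fin N) (Fin N) A⟦X⟧} {G : GaussData A N}
    (h : IsGaussDecomposition T G) {i j : Fin N} (hij : j < i) : Ring.inverse G.F i j = 0 := by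
  induction N with
  | zero => exact i.elim0
  | succ N ih =>
    induction i using Fin.cases with
    | zero => exact absurd hij (Fin.not_lt_zero j)
    | succ i =>
      induction j using Fin.cases with
      | zero => exact h.ringInverse_F_succ_zero i
      | succ j => rw [← h.ringInverse_tail_F, ih h.tail (Fin.succ_lt_succ_iff.1 hij)]

lemma ringInverse_E_diag {N : ℕ} {T : Matrix (Fin N) (Fin N) A⟦X⟧} {G : GaussData A N}
    (h : IsGaussDecomposition T G) (i : Fin N) : Ring.inverse G.E i i = 1 := by
  induction N with
  | zero => exact i.elim0
  | succ N ih =>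
    induction i using Fin.cases with
    | zero => exact h.ringInverse_E_zero_zero
    | succ i => rw [← h.ringInverse_tail_E, ih h.tail]

lemma ringInverse_E_lower {N : ℕ} {T : Matrix (Fin N) (Fin N) A⟦X⟧} {G : GaussData A N}
    (h : IsGaussDecomposition T G) {i j : Fin N} (hij : i < j) : Ring.inverse G.E i j = 0 := by
  induction N with
  | zero => exact i.elim0
  | succ N ih =>
    induction j using Fin.cases with
    | zero => exact absurd hij (Fin.not_lt_zero i)
    | succ j =>
      induction i using Fin.cases with
      | zero => exact h.ringInverse_E_zero_succ j
      | succ i => rw [← h.ringInverse_tail_E, ih h.tail (Fin.succ_lt_succ_iff.1 hij)]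

end IsGaussDecomposition

end Gauss

/-! ### Consequences of the RTT relation -/

section TensorProduct

variable {B : Type*} [Ring B] {N : ℕ}

lemma kronecker_one_mul_kronecker_one (M M' : Matrix (Fin N) (Fin N) B) :
    (M ⊗ₖ (1 : Matrix (Fin N) (Fin N) B)) * (M' ⊗ₖ 1) = (M * M') ⊗ₖ 1 := by
  ext ⟨i, k⟩ ⟨j, l⟩
  simp [Matrix.mul_apply, Fintype.sum_prod_type, Matrix.one_apply]

lemma one_kronecker_mul_one_kronecker (M M' : Matrix (Fin N) (Fin N) B) :
    ((1 : Matrix (Fin N) (Fin N) B) ⊗ₖ M) * (1 ⊗ₖ M') = 1 ⊗ₖ (M * M') := by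
  ext ⟨i, k⟩ ⟨j, l⟩
  simp [Matrix.mul_apply, Fintype.sum_prod_type, Matrix.one_apply]

lemma kronecker_one_map_mul_eq_one {R : Type*} [Ring R] (φ : R →+* B)
    {M M' : Matrix (Fin N) (Fin N) R} (h : M * M' = 1) :
    (M.map φ ⊗ₖ 1) * (M'.map φ ⊗ₖ 1) = (1 : Matrix (Fin N × Fin N) (Fin N × Fin N) B) := by
  rw [kronecker_one_mul_kronecker_one, ← Matrix.map_mul, h]
  simp [Matrix.map_one]

lemma one_kronecker_map_mul_eq_one {R : Type*} [Ring R] (φ : R →+* B)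
    {M M' : Matrix (Fin N) (Fin N) R} (h : M * M' = 1) :
    (1 ⊗ₖ M.map φ) * (1 ⊗ₖ M'.map φ) = (1 : Matrix (Fin N × Fin N) (Fin N × Fin N) B) := by
  rw [one_kronecker_mul_one_kronecker, ← Matrix.map_mul, h]
  simp [Matrix.map_one]

lemma kronecker_one_mul_apply (M : Matrix (Fin N) (Fin N) B)
    (K : Matrix (Fin N × Fin N) (Fin N × Fin N) B) (i k : Fin N) (q : Fin N × Fin N) :
    ((M ⊗ₖ (1 : Matrix (Fin N) (Fin N) B)) * K) (i, k) q = ∑ p, M i p * K (p, k) q := by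
  simp [Matrix.mul_apply, Fintype.sum_prod_type, Matrix.one_apply]

lemma one_kronecker_mul_apply (M : Matrix (Fin N) (Fin N) B)
    (K : Matrix (Fin N × Fin N) (Fin N × Fin N) B) (i k : Fin N) (q : Fin N × Fin N) :
    (((1 : Matrix (Fin N) (Fin N) B) ⊗ₖ M) * K) (i, k) q = ∑ p, M k p * K (i, p) q := by
  simp [Matrix.mul_apply, Fintype.sum_prod_type, Matrix.one_apply]

lemma kronecker_one_mul_one_kronecker_apply (M M' : Matrix (Fin N) (Fin N) B) (i k j l : Fin N) :
    ((M ⊗ₖ 1) * (1 ⊗ₖ M') : Matrix (Fin N × Fin N) (Fin N × Fin N) B) (i, k) (j, l) =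
      M i j * M' k l := by
  simp [kronecker_one_mul_apply, Matrix.one_apply]

lemma one_kronecker_mul_kronecker_one_apply (M M' : Matrix (Fin N) (Fin N) B) (i k j l : Fin N) :
    ((1 ⊗ₖ M') * (M ⊗ₖ 1) : Matrix (Fin N × Fin N) (Fin N × Fin N) B) (i, k) (j, l) =
      M' k l * M i j := by
  simp [one_kronecker_mul_apply, Matrix.one_apply]

end TensorProduct

section RMatrix

variable {A : Type*} [Ring A] {N : ℕ}

lemma permOp_apply (p q : Fin N × Fin N) :
    permOp A N p q = if q = p.swap then 1 else 0 := by
  obtain ⟨i, k⟩ := p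
  obtain ⟨j, l⟩ := q
  have h : ∀ x y : Fin N, Matrix.single (x, y) (y, x) (1 * 1 : A⟦X⟧⟦X⟧) (i, k) (j, l) =
      if x = i then if y = k then if (j, l) = (i, k).swap then 1 else 0 else 0 else 0 := by
    intro x y
    simp only [Matrix.single_apply, Prod.mk.injEq, Prod.swap_prod_mk, mul_one]
    grind
  simp only [permOp, Matrix.single_kronecker_single, Matrix.sum_apply, h]
  simp

lemma vInv_sub_uInv_commute (f : A⟦X⟧⟦X⟧) : Commute f (vInv A - uInv A) := by
  refine Commute.sub_right ?_ (PowerSeries.commute_X f)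
  refine PowerSeries.ext fun n => ?_
  rw [vInv, coeff_mul_C, coeff_C_mul, (PowerSeries.commute_X _).eq]

variable [Algebra ℂ A]

lemma smul_uInv_mul_vInv_commute (c : ℂ) (f : A⟦X⟧⟦X⟧) : Commute f (c • (uInv A * vInv A)) := by
  refine Commute.smul_right ((PowerSeries.commute_X f).mul_right ?_) c
  simpa [uInv] using (vInv_sub_uInv_commute f).add_right (PowerSeries.commute_X f)

lemma clearedR_mul_apply (c : ℂ) (K : Matrix (Fin N × Fin N) (Fin N × Fin N) A⟦X⟧⟦X⟧)
    (p q : Fin N × Fin N) : (clearedR A N c * K) p q =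
      (vInv A - uInv A) * K p q + (c • (uInv A * vInv A)) * K p.swap q := by
  simp only [clearedR, add_mul, Matrix.smul_mul, one_mul, Matrix.add_apply, Matrix.smul_apply,
    smul_eq_mul, Matrix.mul_apply (M := permOp A N), permOp_apply]
  simp

lemma mul_clearedR_apply (c : ℂ) (K : Matrix (Fin N × Fin N) (Fin N × Fin N) A⟦X⟧⟦X⟧)
    (p q : Fin N × Fin N) : (K * clearedR A N c) p q =
      (vInv A - uInv A) * K p q + (c • (uInv A * vInv A)) * K p q.swap := by
  have h : ∀ r : Fin N × Fin N, (q = r.swap) = (r = q.swap) := fun r => by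
    rw [eq_iff_iff, ← Prod.swap_inj, Prod.swap_swap, eq_comm]
  rw [← (vInv_sub_uInv_commute _).eq, ← (smul_uInv_mul_vInv_commute c _).eq]
  simp only [clearedR, mul_add, Matrix.add_apply, Matrix.mul_apply, permOp_apply,
    Matrix.smul_apply, h, Matrix.one_apply]
  simp [Finset.sum_add_distrib]

namespace IsMonodromy

variable {c : ℂ} {T : Matrix (Fin N) (Fin N) A⟦X⟧}

/-- Multiply the RTT relation by `T(v)⁻¹` from both sides. The `P` part of the R-matrix then
contributes to the entry `((i, k), (j, l))` only if `i = l` or `k = j`. -/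
lemma commute_ringInverse (hT : IsMonodromy c T) (hu : IsUnit T) {i j k l : Fin N} (hil : i ≠ l)
    (hkj : k ≠ j) : Commute (atU A (T i j)) (atV A (Ring.inverse T k l)) := by
  set t := Ring.inverse T with ht
  have h1 := one_kronecker_map_mul_eq_one (atV A) (Ring.inverse_mul_cancel _ hu)
  have h2 := one_kronecker_map_mul_eq_one (atV A) (Ring.mul_inverse_cancel _ hu)
  rw [← ht] at h1 h2
  have h := hT.rtt
  rw [RTT] at h
  have h3 : (1 ⊗ₖ t.map (atV A)) * (clearedR A N c * (T.map (atU A) ⊗ₖ 1)) =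
      (T.map (atU A) ⊗ₖ 1) * (clearedR A N c * (1 ⊗ₖ t.map (atV A))) := by
    calc _ = (1 ⊗ₖ t.map (atV A)) * ((clearedR A N c * (T.map (atU A) ⊗ₖ 1)) *
          ((1 ⊗ₖ T.map (atV A)) * (1 ⊗ₖ t.map (atV A)))) := by rw [h2, mul_one]
      _ = (1 ⊗ₖ t.map (atV A)) * ((clearedR A N c * (T.map (atU A) ⊗ₖ 1) * (1 ⊗ₖ T.map (atV A))) *
          (1 ⊗ₖ t.map (atV A))) := by simp only [mul_assoc]
      _ = ((1 ⊗ₖ t.map (atV A)) * (1 ⊗ₖ T.map (atV A))) * ((T.map (atU A) ⊗ₖ 1) *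
          (clearedR A N c * (1 ⊗ₖ t.map (atV A)))) := by rw [h]; simp only [mul_assoc]
      _ = _ := by rw [h1, one_mul]
  have h4 := Matrix.ext_iff.2 h3 (i, k) (j, l)
  simp only [one_kronecker_mul_apply, kronecker_one_mul_apply, clearedR_mul_apply] at h4
  simp only [Matrix.kroneckerMap_apply, Prod.swap_prod_mk, Matrix.one_apply, hil, hkj,
    Matrix.map_apply, if_false, mul_zero, zero_mul, add_zero, mul_ite, ite_mul, mul_one, one_mul,
    Finset.sum_ite_eq', Finset.mem_univ, if_true] at h4
  rw [← mul_assoc, ← mul_assoc, (vInv_sub_uInv_commute _).eq, (vInv_sub_uInv_commute _).eq,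
    mul_assoc, mul_assoc] at h4
  have h5 : (vInv A + uInv A * (-1)) *
      (atU A (T i j) * atV A (t k l) - atV A (t k l) * atU A (T i j)) = 0 := by
    rw [mul_neg_one, ← sub_eq_add_neg, mul_sub, h4, sub_self]
  exact sub_eq_zero.1 (eq_zero_of_vInv_add_mul _ _ h5)

/-- The RTT relation for the inverse matrix `t = T⁻¹`, in components. -/
lemma rtt_ringInverse (hT : IsMonodromy c T) (hu : IsUnit T) (i j k l : Fin N) :
    (vInv A - uInv A) * (atU A (Ring.inverse T i j) * atV A (Ring.inverse T k l)) +
        (c • (uInv A * vInv A)) * (atU A (Ring.inverse T i l) * atV A (Ring.inverse T k j)) =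
      (vInv A - uInv A) * (atV A (Ring.inverse T k l) * atU A (Ring.inverse T i j)) +
        (c • (uInv A * vInv A)) * (atV A (Ring.inverse T i l) * atU A (Ring.inverse T k j)) := by
  set t := Ring.inverse T with ht
  have h1 := one_kronecker_map_mul_eq_one (atV A) (Ring.inverse_mul_cancel _ hu)
  have h2 := one_kronecker_map_mul_eq_one (atV A) (Ring.mul_inverse_cancel _ hu)
  have h1' := kronecker_one_map_mul_eq_one (atU A) (Ring.inverse_mul_cancel _ hu)
  have h2' := kronecker_one_map_mul_eq_one (atU A) (Ring.mul_inverse_cancel _ hu)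
  rw [← ht] at h1 h2 h1' h2'
  have h := hT.rtt
  rw [RTT] at h
  have h3 : (t.map (atU A) ⊗ₖ 1) * (1 ⊗ₖ t.map (atV A)) * clearedR A N c =
      clearedR A N c * ((1 ⊗ₖ t.map (atV A)) * (t.map (atU A) ⊗ₖ 1)) := by
    generalize (t.map (atU A) ⊗ₖ 1 : Matrix (Fin N × Fin N) (Fin N × Fin N) A⟦X⟧⟦X⟧) = a' at *
    generalize (T.map (atU A) ⊗ₖ 1 : Matrix (Fin N × Fin N) (Fin N × Fin N) A⟦X⟧⟦X⟧) = a at *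
    generalize (1 ⊗ₖ t.map (atV A) : Matrix (Fin N × Fin N) (Fin N × Fin N) A⟦X⟧⟦X⟧) = b' at *
    generalize (1 ⊗ₖ T.map (atV A) : Matrix (Fin N × Fin N) (Fin N × Fin N) A⟦X⟧⟦X⟧) = b at *
    generalize clearedR A N c = R at *
    calc a' * b' * R = a' * b' * (R * (a * (b * b') * a')) := by rw [h2, mul_one, h2', mul_one]
      _ = a' * b' * (R * a * b) * (b' * a') := by simp only [mul_assoc]
      _ = a' * (b' * b) * a * (R * (b' * a')) := by rw [h]; simp only [mul_assoc]
      _ = _ := by rw [h1, mul_one, h1', one_mul]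
  have h4 := Matrix.ext_iff.2 h3 (i, k) (j, l)
  simpa only [clearedR_mul_apply, mul_clearedR_apply, Prod.swap_prod_mk,
    kronecker_one_mul_one_kronecker_apply, one_kronecker_mul_kronecker_one_apply,
    Matrix.map_apply] using h4

/-- For equal entries the RTT relation is the commutator times `1 + c / (u - v)`, which can be
cancelled. -/
lemma commute_diag_ringInverse (hT : IsMonodromy c T) (hu : IsUnit T) (i : Fin N) :
    Commute (atU A (Ring.inverse T i i)) (atV A (Ring.inverse T i i)) := by
  have h := hT.rtt_ringInverse hu i i i i
  have h5 : (vInv A + uInv A * (c • vInv A - 1)) *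
      (atU A (Ring.inverse T i i) * atV A (Ring.inverse T i i) -
        atV A (Ring.inverse T i i) * atU A (Ring.inverse T i i)) = 0 := by
    have h6 : vInv A + uInv A * (c • vInv A - 1) =
        (vInv A - uInv A) + c • (uInv A * vInv A) := by
      rw [mul_sub, mul_one, mul_smul_comm]
      abel
    rw [h6, mul_sub, add_mul, add_mul, h, sub_self]
  exact sub_eq_zero.1 (eq_zero_of_vInv_add_mul _ _ h5)

end IsMonodromy

lemma evalU_smul (a r : ℂ) (f : A⟦X⟧⟦X⟧) : evalU a (r • f) = r • evalU a f := by
  ext n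
  change coeff n (evalUFun a _) = coeff n (r • evalUFun a _)
  simp [evalUFun, Finset.smul_sum]

lemma shiftedVarIn_mul_one_sub (a : ℂ) :
    shiftedVarIn A a * (1 - a • X) = X := by
  have := congrArg (PowerSeries.map (algebraMap ℂ A)) (shiftedVar_mul_one_sub a)
  have h : (a • X : A⟦X⟧) = C (algebraMap ℂ A a) * X := by
    ext n
    rw [coeff_C_mul, ← Algebra.smul_def]
    rfl
  simpa [h, shiftedVarIn] using this

/-- The RTT relation for `t = T⁻¹` at `u = v - c`, where for `c ≠ 0` the R-matrix degenerates to
`I ⊗ I - P`. -/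
lemma IsMonodromy.fusion {c : ℂ} {T : Matrix (Fin N) (Fin N) A⟦X⟧} (hT : IsMonodromy c T)
    (hu : IsUnit T) (i j k l : Fin N) :
    shift c (Ring.inverse T i j) * Ring.inverse T k l -
        Ring.inverse T k l * shift c (Ring.inverse T i j) =
      shift c (Ring.inverse T i l) * Ring.inverse T k j -
        Ring.inverse T i l * shift c (Ring.inverse T k j) := by
  have h := hT.rtt_ringInverse hu
  generalize Ring.inverse T = t at *
  -- For `c = 0` both sides of the specialized relation are multiplied by `0`, so that the factor
  -- `v⁻¹ - u⁻¹` has to be cancelled before specializing.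
  rcases eq_or_ne c 0 with rfl | hc
  · have hcomm : ∀ i j k l, t i j * t k l = t k l * t i j := by
      intro i j k l
      have h5 : (vInv A + uInv A * (-1)) *
          (atU A (t i j) * atV A (t k l) - atV A (t k l) * atU A (t i j)) = 0 := by
        rw [mul_neg_one, ← sub_eq_add_neg, mul_sub, sub_eq_zero]
        simpa using h i j k l
      have h6 := congrArg (evalU 0) (eq_zero_of_vInv_add_mul _ _ h5)
      simpa [evalU_atU, evalU_atV, shift_zero, sub_eq_zero] using h6
    simp only [shift_zero]
    rw [hcomm i j k l, sub_self, sub_self]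
  · have h1 := congrArg (evalU c) (h i j k l)
    have hX : evalU c (vInv A) = X := evalU_atV c X
    simp only [map_add, map_mul, map_sub, evalU_atU, evalU_atV, evalU_smul, evalU_uInv, hX] at h1
    have hs : (X : A⟦X⟧) - shiftedVarIn A c = -(c • (shiftedVarIn A c * X)) := by
      conv_lhs => rw [← shiftedVarIn_mul_one_sub c]
      simp [mul_sub]
    rw [hs] at h1
    set D := shift c (t i j) * t k l - t k l * shift c (t i j) -
      (shift c (t i l) * t k j - t i l * shift c (t k j)) with hD
    have h2 : c • (shiftedVarIn A c * (X * D)) = 0 := by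
      rw [← mul_assoc, ← smul_mul_assoc, hD]
      simp only [mul_sub]
      rw [neg_mul, neg_mul] at h1
      refine Eq.trans ?_ (sub_eq_zero.2 h1.symm)
      abel
    have h3 : shiftedVarIn A c * (X * D) = 0 := (smul_eq_zero_iff_right hc).1 h2
    have h4 : X * (X * D) = 0 := by
      calc X * (X * D) = (1 - c • X) * (shiftedVarIn A c * (X * D)) := by
            rw [← mul_assoc (1 - c • X), ← (shiftedVarIn_commute c _).eq, shiftedVarIn_mul_one_sub]
        _ = 0 := by rw [h3, mul_zero]
    have h5 : D = 0 := by
      refine PowerSeries.X_mul_injective (PowerSeries.X_mul_injective ?_)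
      simpa using h4
    exact sub_eq_zero.1 h5

end RMatrix

/-! ### Commutation of the Gauss coordinates -/

section Commutation

lemma commute_ringInverse_of_isUnit {R : Type*} [Ring R] {x y : R} (h : Commute x y)
    (hy : IsUnit y) : Commute x (Ring.inverse y) := by
  obtain ⟨y, rfl⟩ := hy
  rw [Ring.inverse_unit]
  exact h.units_inv_right

lemma commute_ringInverse_entries {R : Type*} [Ring R] {N : ℕ} {x : R}
    {M : Matrix (Fin N) (Fin N) R} (hM : IsUnit M) (h : ∀ i j, Commute x (M i j)) (i j : Fin N) :
    Commute x (Ring.inverse M i j) := by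
  have h1 : Commute (Matrix.diagonal fun _ => x) M := by
    ext i j
    simpa using (h i j).eq
  have h2 := Matrix.ext_iff.2 (commute_ringInverse_of_isUnit h1 hM).eq i j
  rwa [Matrix.diagonal_mul, Matrix.mul_diagonal] at h2

variable {A : Type*} [Ring A] {N : ℕ}

/-- The image of a triple of coordinates under a ring homomorphism. -/
def GaussData.map {A' : Type*} [Ring A'] (φ : A⟦X⟧ →+* A'⟦X⟧) (G : GaussData A N) :
    GaussData A' N where
  F := G.F.map φ
  k i := φ (G.k i)
  E := G.E.map φ

namespace IsGaussDecomposition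

variable {T : Matrix (Fin N) (Fin N) A⟦X⟧} {G : GaussData A N}

lemma map {A' : Type*} [Ring A'] (φ : A⟦X⟧ →+* A'⟦X⟧) (h : IsGaussDecomposition T G) :
    IsGaussDecomposition (T.map φ) (G.map φ) where
  F_diag i := by simp [GaussData.map, h.F_diag]
  F_upper i j hij := by simp [GaussData.map, h.F_upper i j hij]
  E_diag i := by simp [GaussData.map, h.E_diag]
  E_lower i j hij := by simp [GaussData.map, h.E_lower i j hij]
  eq := by
    ext1 i j
    rw [Matrix.map_apply, h.apply, map_sum, Matrix.mul_apply]
    simp [GaussData.map, Matrix.mul_diagonal]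

/-- An invertible series that commutes with the entries of `T` commutes with its Gauss coordinates:
conjugation by it fixes `T`, hence its unique decomposition. -/
lemma commute_coordinates_of_commute (h : IsGaussDecomposition T G)
    (hk : ∀ i, IsUnit (G.k i)) (x : A⟦X⟧ˣ) (hx : ∀ i j, Commute (x : A⟦X⟧) (T i j)) :
    (∀ i, Commute (x : A⟦X⟧) (G.k i)) ∧ ∀ i j, Commute (x : A⟦X⟧) (G.E i j) := by
  let φ : A⟦X⟧ →+* A⟦X⟧ :=
    MulSemiringAction.toRingHom (ConjAct A⟦X⟧ˣ) A⟦X⟧ (ConjAct.toConjAct x)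
  have hφ : ∀ y, φ y = y ↔ Commute (x : A⟦X⟧) y := fun y => by
    change ConjAct.toConjAct x • y = y ↔ _
    rw [ConjAct.units_smul_def, ConjAct.ofConjAct_toConjAct, Units.mul_inv_eq_iff_eq_mul]
    rfl
  have hT : T.map φ = T := by
    ext1 i j
    exact (hφ _).2 (hx i j)
  have hG := h.unique hk (hT ▸ h.map φ)
  exact ⟨fun i => (hφ _).1 (congrFun (congrArg GaussData.k hG) i),
    fun i j => (hφ _).1 (Matrix.ext_iff.2 (congrArg GaussData.E hG) i j)⟩

/-- Two-parameter version: if `f(u)` is invertible and commutes with the entries of `T(v)`, then it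
commutes with the Gauss coordinates at `v`. -/
lemma commute_coordinates (h : IsGaussDecomposition T G) (hk : ∀ i, IsUnit (G.k i)) {f : A⟦X⟧}
    (hf : IsUnit f) (hx : ∀ i j, Commute (atU A f) (atV A (T i j))) :
    (∀ i, Commute (atU A f) (atV A (G.k i))) ∧
      ∀ i j, Commute (atU A f) (atV A (Ring.inverse G.E i j)) := by
  obtain ⟨x, hxf⟩ := hf.map (atU A)
  rw [← hxf] at hx ⊢
  obtain ⟨h1, h2⟩ :=
    (h.map (atV A)).commute_coordinates_of_commute (fun i => (hk i).map (atV A)) x hx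
  refine ⟨h1, fun i j => ?_⟩
  have h3 : Ring.inverse (G.E.map (atV A)) = (Ring.inverse G.E).map (atV A) := by
    refine ringInverse_eq_of_mul_eq_one (h.map (atV A)).isUnit_E ?_
    rw [← Matrix.map_mul, Ring.mul_inverse_cancel _ h.isUnit_E]
    simp [Matrix.map_one]
  have h4 := commute_ringInverse_entries (h.map (atV A)).isUnit_E h2 i j
  rwa [show (G.map (atV A)).E = G.E.map (atV A) from rfl, h3] at h4

end IsGaussDecomposition

lemma commute_of_commute_ringInverse {f g : A⟦X⟧} (hf : IsUnit f)
    (h : Commute (atU A (Ring.inverse f)) (atV A g)) : Commute (atU A f) (atV A g) := by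
  obtain ⟨x, rfl⟩ := hf
  rw [Ring.inverse_unit] at h
  exact Commute.units_inv_left_iff (u := Units.map (atU A).toMonoidHom x).1 h

variable [Algebra ℂ A]

lemma rtt_iff {c : ℂ} {T : Matrix (Fin N) (Fin N) A⟦X⟧} : RTT c T ↔ ∀ i j k l,
    (vInv A - uInv A) * (atU A (T i j) * atV A (T k l)) +
        (c • (uInv A * vInv A)) * (atU A (T k j) * atV A (T i l)) =
      (vInv A - uInv A) * (atV A (T k l) * atU A (T i j)) +
        (c • (uInv A * vInv A)) * (atV A (T k j) * atU A (T i l)) := by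
  rw [RTT, mul_assoc (clearedR A N c), ← Matrix.ext_iff]
  simp only [Prod.forall, clearedR_mul_apply, mul_clearedR_apply, Prod.swap_prod_mk,
    kronecker_one_mul_one_kronecker_apply, one_kronecker_mul_kronecker_one_apply, Matrix.map_apply]
  exact ⟨fun h i j k l => h i k j l, fun h i k j l => h i j k l⟩

namespace IsMonodromy

lemma tail {c : ℂ} {T : Matrix (Fin (N + 1)) (Fin (N + 1)) A⟦X⟧} (hT : IsMonodromy c T) :
    IsMonodromy c (T.submatrix Fin.succ Fin.succ) where
  rtt := rtt_iff.2 fun _ _ _ _ => rtt_iff.1 hT.rtt _ _ _ _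
  constantCoeff := by
    ext i j
    simpa [Matrix.one_apply] using Matrix.ext_iff.2 hT.constantCoeff i.succ j.succ

section

variable {c : ℂ} {T : Matrix (Fin (N + 1)) (Fin (N + 1)) A⟦X⟧} {G : GaussData A (N + 1)}

/-- `k₁(u) = T̃₁₁(u)⁻¹` commutes with the trailing block of `T(v)`. -/
lemma commute_k_zero_tail (hT : IsMonodromy c T) (hG : IsGaussDecomposition T G)
    (hk : ∀ i, IsUnit (G.k i)) (i j : Fin N) :
    Commute (atU A (G.k 0)) (atV A (T i.succ j.succ)) := by
  have h := hT.commute_ringInverse (hG.isUnit hk) (Fin.succ_ne_zero i) (Fin.succ_ne_zero j).symm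
  rw [hG.ringInverse_zero_zero hk] at h
  exact commute_of_commute_ringInverse (hk 0) (commute_atU_atV_symm h)

lemma commute_k_zero_k (hT : IsMonodromy c T) (hG : IsGaussDecomposition T G)
    (hk : ∀ i, IsUnit (G.k i)) (i : Fin (N + 1)) :
    Commute (atU A (G.k 0)) (atV A (G.k i)) := by
  induction i using Fin.cases with
  | zero =>
    have h := hT.commute_diag_ringInverse (hG.isUnit hk) 0
    rw [hG.ringInverse_zero_zero hk] at h
    exact commute_of_commute_ringInverse (hk 0)
      (commute_atU_atV_symm (commute_of_commute_ringInverse (hk 0) h))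
  | succ i =>
    exact (hG.tail.commute_coordinates (fun i => hk _) (hk 0)
      (hT.commute_k_zero_tail hG hk)).1 i

lemma commute_k_zero_ringInverse_E (hT : IsMonodromy c T) (hG : IsGaussDecomposition T G)
    (hk : ∀ i, IsUnit (G.k i)) (i j : Fin N) :
    Commute (atU A (G.k 0)) (atV A (Ring.inverse G.E i.succ j.succ)) := by
  rw [← hG.ringInverse_tail_E]
  exact (hG.tail.commute_coordinates (fun i => hk _) (hk 0) (hT.commute_k_zero_tail hG hk)).2 i j

end

theorem commute_k {N : ℕ} {c : ℂ} {T : Matrix (Fin N) (Fin N) A⟦X⟧} {G : GaussData A N}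
    (hT : IsMonodromy c T) (hG : IsGaussDecomposition T G) (hk : ∀ i, IsUnit (G.k i))
    (i j : Fin N) : Commute (atU A (G.k i)) (atV A (G.k j)) := by
  induction N with
  | zero => exact i.elim0
  | succ N ih =>
    induction i using Fin.cases with
    | zero => exact hT.commute_k_zero_k hG hk j
    | succ i =>
      induction j using Fin.cases with
      | zero => exact commute_atU_atV_symm (hT.commute_k_zero_k hG hk i.succ)
      | succ j => exact ih hT.tail hG.tail (fun i => hk _) i j

end IsMonodromy

end Commutation

/-! ### The hatted coordinates -/

section Hat

variable {A : Type*} [Ring A] {N : ℕ}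

lemma constantCoeff_hatT {T : Matrix (Fin N) (Fin N) A⟦X⟧} (hT : T.map constantCoeff = 1)
    (hu : IsUnit T) : (hatT T).map constantCoeff = 1 := by
  have h : (Ring.inverse T).map constantCoeff = 1 := by
    have : (T * Ring.inverse T).map constantCoeff = 1 := by
      rw [Ring.mul_inverse_cancel _ hu]
      exact Matrix.map_one _ (map_zero _) (map_one _)
    rwa [Matrix.map_mul, hT, one_mul] at this
  ext1 i j
  have := Matrix.ext_iff.2 h j.rev i.rev
  simpa [hatT, Matrix.one_apply, eq_comm] using this

variable [Algebra ℂ A]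

/-- The series `κₘ(u) = kₘ(u - (m-1)c)⁻¹ ∏_{ℓ<m} kₗ(u - ℓc) kₗ(u - (ℓ-1)c)⁻¹` (indices from `1`),
that is, `k̂_{N+1-m}(u)`. -/
def hatK (c : ℂ) (G : GaussData A N) (m : Fin N) : A⟦X⟧ :=
  Ring.inverse (shift ((m : ℂ) * c) (G.k m)) *
    (((List.finRange N).filter fun l : Fin N => l < m).map fun l : Fin N =>
      shift ((((l : ℕ) : ℂ) + 1) * c) (G.k l) *
        Ring.inverse (shift (((l : ℕ) : ℂ) * c) (G.k l))).prod

lemma hatK_zero (c : ℂ) (G : GaussData A (N + 1)) : hatK c G 0 = Ring.inverse (G.k 0) := by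
  simp [hatK, shift_zero]

lemma hatK_succ {c : ℂ} {G : GaussData A (N + 1)} (hk : ∀ i, IsUnit (G.k i))
    (hc : ∀ i, Commute (atU A (G.k 0)) (atV A (G.k i))) (m : Fin N) :
    hatK c G m.succ = shift c (hatK c G.tail m) * (shift c (G.k 0) * Ring.inverse (G.k 0)) := by
  have hs : ∀ (a : ℂ) (i : Fin N), shift c (shift (a * c) (G.tail.k i)) =
      shift ((a + 1) * c) (G.k i.succ) := fun a i => by
    rw [shift_shift, add_mul, one_mul, add_comm]
    rfl
  have hsi : ∀ (a : ℂ) (i : Fin N), shift c (Ring.inverse (shift (a * c) (G.tail.k i))) =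
      Ring.inverse (shift ((a + 1) * c) (G.k i.succ)) := fun a i => by
    rw [shift_ringInverse c (isUnit_shift (a * c) (show IsUnit (G.tail.k i) from hk i.succ)), hs]
  have hcomm : ∀ (a : ℂ) (i : Fin (N + 1)), Commute (shift c (G.k 0) * Ring.inverse (G.k 0))
      (shift a (G.k i)) := fun a i => by
    refine Commute.mul_left (commute_shift_shift (hc i) _ _) ?_
    have := commute_shift_shift (hc i) 0 a
    rw [shift_zero] at this
    exact (commute_ringInverse_of_isUnit this.symm (hk 0)).symm
  have hl : shift c ((((List.finRange N).filter fun l : Fin N => l < m).map fun l : Fin N =>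
      shift ((((l : ℕ) : ℂ) + 1) * c) (G.tail.k l) *
        Ring.inverse (shift (((l : ℕ) : ℂ) * c) (G.tail.k l))).prod) =
      (((List.finRange N).filter fun l : Fin N => l < m).map fun l : Fin N =>
      shift ((((l.succ : ℕ) : ℂ) + 1) * c) (G.k l.succ) *
        Ring.inverse (shift (((l.succ : ℕ) : ℂ) * c) (G.k l.succ))).prod := by
    rw [← shiftHom_apply, map_list_prod, List.map_map]
    congr 2
    ext1 l
    simp only [Function.comp_apply, map_mul, shiftHom_apply, hs, hsi, Fin.val_succ, Nat.cast_add,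
      Nat.cast_one]
  rw [hatK, hatK, shift_mul, hsi, hl, List.finRange_succ, List.filter_cons,
    if_pos (by simp), List.filter_map, List.map_cons, List.map_map, List.prod_cons]
  have hf : ((fun l => decide (l < m.succ)) ∘ Fin.succ : Fin N → Bool) =
      fun l => decide (l < m) := by
    ext1 l
    simp
  rw [hf]
  simp only [Fin.val_zero, Nat.cast_zero, zero_add, one_mul, zero_mul, shift_zero]
  rw [Commute.eq (a := shift c (G.k 0) * Ring.inverse (G.k 0)), mul_assoc]
  · simp [Function.comp_def]
  · refine Commute.list_prod_right _ _ fun y hy => ?_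
    obtain ⟨l, _, rfl⟩ := List.mem_map.1 hy
    exact (hcomm _ _).mul_right
      (commute_ringInverse_of_isUnit (hcomm _ _) (isUnit_shift _ (hk _)))

/-- The entries of `T⁻¹ = E⁻¹ D⁻¹ F⁻¹` with the entries of `F⁻¹` moved to the left of those of
`E⁻¹`. In the induction on `N`, the term `m = 0` takes the first pivot out of `T⁻¹`, and the rest of
the sum is the inverse of the trailing block of `T` at `u - c`, up to the factor
`k₁(u - c) / k₁(u)`. -/
theorem IsMonodromy.ringInverse_apply_eq_sum {N : ℕ} {c : ℂ} {T : Matrix (Fin N) (Fin N) A⟦X⟧}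
    {G : GaussData A N} (hT : IsMonodromy c T) (hG : IsGaussDecomposition T G)
    (hk : ∀ i, IsUnit (G.k i)) (b a : Fin N) :
    Ring.inverse T b a = ∑ m : Fin N, shift (((m : ℂ) + 1) * c) (Ring.inverse G.F m a) *
      hatK c G m * shift (((m : ℂ) + 1) * c) (Ring.inverse G.E b m) := by
  induction N with
  | zero => exact b.elim0
  | succ N ih =>
    have hfus := hT.fusion (hG.isUnit hk)
    have hz := hG.ringInverse_zero_zero hk
    have hl := hG.ringInverse_zero_left hk
    have hr := hG.ringInverse_zero_right hk
    have hκu := (hk 0).ringInverse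
    have hsk := shift_ringInverse c (hk 0)
    have hsκu := isUnit_shift c hκu
    set κ := Ring.inverse (G.k 0) with hκ
    -- Moving `F⁻¹` and `E⁻¹` past `k₁⁻¹` shifts the spectral parameter.
    have hF : ∀ a, κ * Ring.inverse G.F 0 a = shift c (Ring.inverse G.F 0 a) * κ := by
      intro a
      have := hfus 0 0 0 a
      rw [hz, hl, shift_mul, sub_left_inj, mul_assoc] at this
      exact hsκu.mul_left_cancel this
    have hE : ∀ b, Ring.inverse G.E b 0 * κ = κ * shift c (Ring.inverse G.E b 0) := by
      intro b
      have := hfus b 0 0 0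
      rw [hz, hr, shift_mul, sub_right_inj, ← mul_assoc] at this
      exact (hsκu.mul_right_cancel this).symm
    rw [Fin.sum_univ_succ, hatK_zero, ← hκ]
    simp only [Fin.val_zero, Nat.cast_zero, zero_add, one_mul]
    induction a using Fin.cases with
    | zero =>
      simp only [hG.ringInverse_F_succ_zero, shift_zero_series, zero_mul, Finset.sum_const_zero,
        add_zero, hG.ringInverse_F_zero_zero, shift_one, one_mul]
      rw [hr, hE]
    | succ a =>
      induction b using Fin.cases with
      | zero =>
        simp only [hG.ringInverse_E_zero_succ, shift_zero_series, mul_zero, Finset.sum_const_zero,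
          add_zero, hG.ringInverse_E_zero_zero, shift_one, mul_one]
        rw [hl, hF]
      | succ b =>
        set τ := Ring.inverse (T.submatrix Fin.succ Fin.succ) b a with hτ
        have hss := hG.ringInverse_succ_succ hk b a
        rw [← hκ, ← hτ] at hss
        have hsum : ∑ m : Fin N,
            shift ((((m.succ : Fin (N + 1)) : ℂ) + 1) * c) (Ring.inverse G.F m.succ a.succ) *
              hatK c G m.succ *
              shift ((((m.succ : Fin (N + 1)) : ℂ) + 1) * c) (Ring.inverse G.E b.succ m.succ) =
            shift c τ * (shift c (G.k 0) * κ) := by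
          rw [hτ, ih hT.tail hG.tail (fun i => hk _) b a, shift_sum, Finset.sum_mul]
          refine Finset.sum_congr rfl fun m _ => ?_
          rw [hatK_succ hk (hT.commute_k_zero_k hG hk), ← hκ, shift_mul, shift_mul, shift_shift,
            shift_shift, hG.ringInverse_tail_E, hG.ringInverse_tail_F]
          have hm : c + ((m : ℂ) + 1) * c = (((m.succ : Fin (N + 1)) : ℂ) + 1) * c := by
            simp
            ring
          have hcm : Commute (shift c (G.k 0) * κ)
              (shift ((((m.succ : Fin (N + 1)) : ℂ) + 1) * c)
                (Ring.inverse G.E b.succ m.succ)) := by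
            have h0 := fun x y =>
              commute_shift_shift (hT.commute_k_zero_ringInverse_E hG hk b m) x y
            refine (h0 _ _).mul_left ?_
            have := h0 0 ((((m.succ : Fin (N + 1)) : ℂ) + 1) * c)
            rw [shift_zero] at this
            exact (commute_ringInverse_of_isUnit this.symm (hk 0)).symm
          rw [hm]
          simp only [mul_assoc]
          rw [← mul_assoc (shift c (G.k 0)), hcm.eq]
        rw [hsum]
        -- The degenerate relation for `t_{b1}(u - c)` and `t_{1a}(u)` compares the Schur complement
        -- of `t₁₁` in the order `t_{1a} t₁₁⁻¹ t_{b1}` at `u` with the one in the opposite order,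
        -- which is `τ`, at `u - c`.
        have h1 := hfus b.succ 0 0 a.succ
        have h2 : shift c (Ring.inverse T b.succ a.succ) =
            shift c (Ring.inverse G.E b.succ 0) * shift c κ * shift c (Ring.inverse G.F 0 a.succ) +
              shift c τ := by
          rw [hss, shift_add, shift_mul, shift_mul]
        rw [hz, hl, hr, hF, shift_mul, h2, add_mul] at h1
        have h3 : Ring.inverse T b.succ a.succ * shift c κ =
            shift c (Ring.inverse G.F 0 a.succ) * κ * shift c (Ring.inverse G.E b.succ 0) *
              shift c κ + shift c τ * κ := by
          simp only [mul_assoc] at h1 ⊢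
          refine sub_eq_zero.1 (Eq.trans ?_ (sub_eq_zero.2 h1))
          abel
        have h4 : Commute κ (shift c (G.k 0)) := by
          have := commute_shift_shift (hT.commute_k_zero_k hG hk 0) c 0
          rw [shift_zero] at this
          exact (commute_ringInverse_of_isUnit this (hk 0)).symm
        have h5 : shift c κ * shift c (G.k 0) = 1 := by
          rw [hsk, Ring.inverse_mul_cancel _ (isUnit_shift c (hk 0))]
        have h6 := congrArg (· * shift c (G.k 0)) h3
        simpa only [add_mul, mul_assoc, h5, mul_one, h4.eq] using h6

namespace IsGaussDecomposition

/-- The case distinction in the definition of `F̂` is automatic, because `F⁻¹` is unitriangular. -/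
lemma hat_F {T : Matrix (Fin N) (Fin N) A⟦X⟧} {G : GaussData A N} (h : IsGaussDecomposition T G)
    (c : ℂ) (i j : Fin N) : (G.hat c).F i j =
      shift ((((j.rev : ℕ) : ℂ) + 1) * c) (Ring.inverse G.F j.rev i.rev) := by
  simp only [GaussData.hat, Matrix.of_apply]
  split_ifs with h1 h2
  · rw [h1, h.ringInverse_F_diag, shift_one]
  · rfl
  · have : j < i := lt_of_le_of_ne (not_lt.1 h2) (Ne.symm h1)
    rw [h.ringInverse_F_upper (Fin.rev_lt_rev.2 this), shift_zero_series]

/-- The case distinction in the definition of `Ê` is automatic, because `E⁻¹` is unitriangular. -/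
lemma hat_E {T : Matrix (Fin N) (Fin N) A⟦X⟧} {G : GaussData A N} (h : IsGaussDecomposition T G)
    (c : ℂ) (j i : Fin N) : (G.hat c).E j i =
      shift ((((j.rev : ℕ) : ℂ) + 1) * c) (Ring.inverse G.E i.rev j.rev) := by
  simp only [GaussData.hat, Matrix.of_apply]
  split_ifs with h1 h2
  · rw [h1, h.ringInverse_E_diag, shift_one]
  · rfl
  · have : j < i := lt_of_le_of_ne (not_lt.1 h2) (Ne.symm h1)
    rw [h.ringInverse_E_lower (Fin.rev_lt_rev.2 this), shift_zero_series]

end IsGaussDecomposition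

theorem IsMonodromy.isGaussDecomposition_hat {c : ℂ} {T : Matrix (Fin N) (Fin N) A⟦X⟧}
    {G : GaussData A N} (hT : IsMonodromy c T) (hG : IsGaussDecomposition T G)
    (hk : ∀ i, IsUnit (G.k i)) : IsGaussDecomposition (hatT T) (G.hat c) where
  F_diag i := by simp [GaussData.hat]
  F_upper i j hij := by simp [GaussData.hat, hij.ne', hij.not_gt]
  E_diag i := by simp [GaussData.hat]
  E_lower i j hij := by simp [GaussData.hat, hij.ne', hij.not_gt]
  eq := by
    ext1 i j
    rw [Matrix.mul_apply, hatT, Matrix.of_apply, hT.ringInverse_apply_eq_sum hG hk,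
      ← Equiv.sum_comp Fin.revPerm]
    refine Finset.sum_congr rfl fun l _ => ?_
    rw [Matrix.mul_diagonal, hG.hat_F, hG.hat_E]
    rfl

end Hat

end GaussRTT

end

theorem mainTheorem2 {A : Type*} [Ring A] [Algebra ℂ A] (N : ℕ) (c : ℂ)
    (T : Matrix (Fin N) (Fin N) (PowerSeries A)) (hT : GaussRTT.IsMonodromy c T) :
    -- the inverse monodromy matrix exists
    IsUnit T ∧
    -- `G` is the unique Gauss decomposition of `T`
    ∃ G : GaussRTT.GaussData A N,
      (∀ G' : GaussRTT.GaussData A N, GaussRTT.IsGaussDecomposition T G' ↔ G' = G) ∧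
      -- the inverses and quotients in the hatted coordinates make sense
      IsUnit G.F ∧ IsUnit G.E ∧
      (∀ (a : ℂ) (i : Fin N), IsUnit (GaussRTT.shift a (G.k i))) ∧
      (∀ (a b : ℂ) (i j : Fin N),
        Commute (GaussRTT.shift a (G.k i)) (GaussRTT.shift b (G.k j))) ∧
      -- the hatted coordinates are the unique Gauss decomposition of `T̂`
      (∀ G' : GaussRTT.GaussData A N,
        GaussRTT.IsGaussDecomposition (GaussRTT.hatT T) G' ↔ G' = G.hat c) := by
  obtain ⟨G, hG, hk⟩ := GaussRTT.exists_isGaussDecomposition T hT.constantCoeff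
  have hu := hG.isUnit hk
  obtain ⟨G₀, hG₀, hk₀⟩ := GaussRTT.exists_isGaussDecomposition (GaussRTT.hatT T)
    (GaussRTT.constantCoeff_hatT hT.constantCoeff hu)
  have hhat := hT.isGaussDecomposition_hat hG hk
  refine ⟨hu, G, fun G' => ⟨fun h => hG.unique hk h, fun h => h ▸ hG⟩, hG.isUnit_F, hG.isUnit_E,
    fun a i => GaussRTT.isUnit_shift a (hk i),
    fun a b i j => GaussRTT.commute_shift_shift (hT.commute_k hG hk i j) a b,
    fun G' => ⟨fun h => ?_, fun h => h ▸ hhat⟩⟩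
  -- uniqueness refers to `G₀`, whose series `k` are known to be invertible
  rw [hG₀.unique hk₀ h, hG₀.unique hk₀ hhat]
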